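/- All systems are finite-dimensional with fixed bases. A *channel* is a completely positive trace-preserving linear map; $\mathrm{Ad}_M(K)=MKM^\dagger$; $\phi^+_{XX'}=|X|^{-1}\sum_{i,j}|i\rangle\langle j|_X\otimes|i\rangle\langle j|_{X'}$ is the maximally entangled state of $X$ and a copy $X'$; $\pi_X=\mathbb 1_X/|X|$; and $J^{\mathcal N}=(\mathcal N_X\otimes\mathrm{id}_{X'})(\phi^+_{XX'})$ is the Choi matrix of a linear map $\mathcal N$ on the operators on $X$. For a unitary $W$ on $X\otimes X'$, the *generalized transposition* $\mathfrak T[W]$ sends a linear map $\mathcal N$ on the operators on $X$ to the map $\mathcal N^{T[W]}$ whose Choi matrix is $W J^{\mathcal N}W^\dagger$. A map $\mathcal N$ on the operators on $A\otimes B$ is *compatible with $T_B[W]$* ($W$ a unitary on $B\otimes B'$, where $B'$ is a copy of $B$) if $(\mathfrak{id}_A\otimes\mathfrak T[W])(\mathcal N)$ is a channel. A state $\sigma$ on $B$ is *compatible with $T_B[W]$* if the supermap $\mathcal N\mapsto(\mathcal N^{T[W^\dagger]})(\sigma)$ is a superchannel, that is, it sends channels to channels even when it acts on only a part of a multipartite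 channel. Let $d_S(\rho,\tau)=\sqrt{1-F(\rho,\tau)}$ be the sine metric, with $F(\rho,\tau)=\|\sqrt\rho\sqrt\tau\|_1^2$. For systems $A,B$ with $|A|=|B|$, a linear map $\mathcal M$ on the operators on $A\otimes B$ and a state $\sigma$ on $B$, define the *information non-leakage* $$\mathcal K_{B\langle A}(\mathcal M|\sigma)=\min_{Y:A\to B\text{ unitary}} d_S\big(J^{\mathrm{Tr}_A[\mathcal M(\,\cdot\,\otimes\sigma)]},\,J^{\mathrm{Ad}_Y}\big)$$ and the *non-catalyticity* $$\mathcal D_{B\langle A}(\mathcal M|\sigma)=\min_{\xi\text{ a state on }B} d_S\big(\mathrm{Tr}_A[\mathcal M(\phi^+_{AA'}\otimes\sigma_B^T)],\ \pi_{A'}\otimes\xi_B\big),$$ where $\mathcal M$ acts on $AB$. **Proposition.** Let $|A|=|B|$, let $U$ be a unitary on $A\otimes B$, $\mathcal U=\mathrm{Ad}_U$, let $W$ be a unitary on $B\otimes B'$, $\mathcal W=\mathrm{Ad}_W$, and suppose that $\mathcal U$ is compatible with $T_B[W]$. Then for every state $\sigma$ on $B$ that is compatible with $T_B[W]$, $$\mathcal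 D_{B'\langle B}(\mathcal W|\sigma)\le 2\,\mathcal K_{B\langle A}(\mathcal U|\sigma).$$ -/

import Mathlib

open scoped ComplexOrder MatrixOrder Kronecker Matrix

namespace QTime

noncomputable section

/-! Finite quantum systems are finite index types with their computational bases: `𝔅(X)` is
`Matrix x x ℂ` and a composite system has the product index type, in the displayed order. -/

/-- `𝔏(X, Y)`: the linear maps from the operators on `X` to the operators on `Y`. -/
abbrev OpMap (x y : Type*) : Type _ := Matrix x x ℂ →ₗ[ℂ] Matrix y y ℂ

/-- `𝔖(X)`: density matrices. -/
def IsState {x : Type*} [Fintype x] (ρ : Matrix x x ℂ) : Prop :=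
  ρ.PosSemidef ∧ ρ.trace = 1

/-- The operator on `X` in position `(p, p')` of an operator on `R ⊗ X`. -/
def opBlock {r x : Type*} (M : Matrix (r × x) (r × x) ℂ) (p p' : r) : Matrix x x ℂ :=
  Matrix.of fun i j => M (p, i) (p', j)

/-- The partial trace `Tr_A` over the first tensor factor. -/
def traceFst {a b : Type*} [Fintype a] (M : Matrix (a × b) (a × b) ℂ) : Matrix b b ℂ :=
  ∑ i, opBlock M i i

/-- Complete positivity: `id_k ⊗ N` preserves positive semidefiniteness for every `k`. -/
def IsCompletelyPositive {x y : Type*} (N : OpMap x y) : Prop :=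
  ∀ (k : ℕ) (M : Matrix (Fin k × x) (Fin k × x) ℂ), M.PosSemidef →
    (Matrix.of fun (p q : Fin k × y) => N (opBlock M p.1 q.1) p.2 q.2).PosSemidef

/-- `ℭ(X, Y)`: quantum channels, i.e. completely positive trace-preserving linear maps. -/
def IsChannel {x y : Type*} [Fintype x] [Fintype y] (N : OpMap x y) : Prop :=
  IsCompletelyPositive N ∧ ∀ ρ, (N ρ).trace = ρ.trace

/-- `Ad_M(K) = M K M†`. -/
def Ad {x y : Type*} [Fintype x] (M : Matrix y x ℂ) : OpMap x y where
  toFun K := M * K * Mᴴ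
  map_add' K L := by rw [Matrix.mul_add, Matrix.add_mul]
  map_smul' c K := by simp

/-- The Choi matrix `J^N = (N ⊗ id)(φ⁺_{XX'})` on `Y ⊗ X'` (output first), where
`φ⁺ = |X|⁻¹ ∑ |i⟩⟨j| ⊗ |i⟩⟨j|` is the normalized maximally entangled state. -/
def choi {x y : Type*} [Fintype x] [DecidableEq x] (N : OpMap x y) :
    Matrix (y × x) (y × x) ℂ :=
  Matrix.of fun p q => (Fintype.card x : ℂ)⁻¹ * N (Matrix.single p.2 q.2 1) p.1 q.1

/-- The inverse `J⁻¹` of the Choi isomorphism: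
`J⁻¹(C)(ρ) = |X| ∑_{k,l} ρ_{kl} (1 ⊗ ⟨k|) C (1 ⊗ |l⟩)`. -/
def ofChoi {x y : Type*} [Fintype x] (C : Matrix (y × x) (y × x) ℂ) : OpMap x y where
  toFun ρ := Matrix.of fun i j =>
    (Fintype.card x : ℂ) * ∑ k, ∑ l, ρ k l * C (i, k) (j, l)
  map_add' ρ τ := by
    ext i j
    simp [add_mul, Finset.sum_add_distrib, mul_add]
  map_smul' c ρ := by
    ext i j
    simp only [Matrix.of_apply, Matrix.smul_apply, smul_eq_mul, RingHom.id_apply, mul_assoc,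
      ← Finset.mul_sum]
    ring

/-- The generalized transposition of linear maps, `𝔗[W](N) = J⁻¹(W J^N W†)`, for an operator `W` on
`X ⊗ X'` (output factor first, input factor second). It sends `Ad_M` to `Ad_{M^{T[W]}}` with
`M^{T[W]} = ∑_{i,j} (1 ⊗ ⟨j|) W (M|i⟩ ⊗ |i⟩⟨j|)`. -/
def genTranspose {x : Type*} [Fintype x] [DecidableEq x] (W : Matrix (x × x) (x × x) ℂ) :
    OpMap x x →ₗ[ℂ] OpMap x x where
  toFun N := ofChoi (W * choi N * Wᴴ)
  map_add' N L := by
    have h : choi (N + L) = choi N + choi L := by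
      ext p q; simp [choi, mul_add]
    rw [h, Matrix.mul_add, Matrix.add_mul]
    ext ρ i j
    simp [ofChoi, mul_add, Finset.sum_add_distrib]
  map_smul' c N := by
    have h : choi (c • N) = c • choi N := by
      ext p q; simp [choi, mul_left_comm]
    rw [h]
    refine LinearMap.ext fun ρ => ?_
    ext i j
    simp only [ofChoi, Matrix.mul_smul, Matrix.smul_mul, Matrix.smul_apply, smul_eq_mul,
      LinearMap.coe_mk, AddHom.coe_mk, Matrix.of_apply, RingHom.id_apply, LinearMap.smul_apply,
      mul_left_comm _ c, ← Finset.mul_sum]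

/-- For `N` from `R ⊗ X` to `S ⊗ Y`, the map `ρ ↦ (⟨q| ⊗ 1) N(|p⟩⟨p'| ⊗ ρ) (|q'⟩ ⊗ 1)`
from operators on `X` to operators on `Y`. -/
def mapBlock {r s x y : Type*} [DecidableEq r] (N : OpMap (r × x) (s × y))
    (p p' : r) (q q' : s) : OpMap x y where
  toFun ρ := opBlock (N (Matrix.single p p' 1 ⊗ₖ ρ)) q q'
  map_add' ρ τ := by
    rw [Matrix.kronecker_add, map_add]; rfl
  map_smul' c ρ := by
    rw [Matrix.kronecker_smul, map_smul]; rfl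

/-- `(id ⊗ Θ)(N)`: the action of the supermap `Θ` on the second factor of a map `N` from
`R ⊗ X₀` to `S ⊗ X₁`. -/
def superTensor {r s x₀ x₁ y₀ y₁ : Type*} [Fintype r] [DecidableEq r]
    (Θ : OpMap x₀ x₁ →ₗ[ℂ] OpMap y₀ y₁) (N : OpMap (r × x₀) (s × x₁)) :
    OpMap (r × y₀) (s × y₁) where
  toFun M := Matrix.of fun u v =>
    ∑ p, ∑ p', Θ (mapBlock N p p' u.1 v.1) (opBlock M p p') u.2 v.2
  map_add' M L := by
    have h : ∀ p p' : r, opBlock (M + L) p p' = opBlock M p p' + opBlock L p p' :=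
      fun _ _ => rfl
    ext u v
    simp [h, Finset.sum_add_distrib]
  map_smul' c M := by
    have h : ∀ p p' : r, opBlock (c • M) p p' = c • opBlock M p p' := fun _ _ => rfl
    ext u v
    simp [h, Finset.mul_sum]

/-- A superchannel: a supermap that sends channels to channels, also when it acts only on a part of
a multipartite channel. -/
def IsSuperchannel {x₀ x₁ y₀ y₁ : Type*} [Fintype x₀] [Fintype x₁] [Fintype y₀] [Fintype y₁]
    (Θ : OpMap x₀ x₁ →ₗ[ℂ] OpMap y₀ y₁) : Prop :=
  ∀ (r s : ℕ) (N : OpMap (Fin r × x₀) (Fin s × x₁)), IsChannel N → IsChannel (superTensor Θ N)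

/-- The state preparation `𝔓^σ(N) = N(σ)`, as a supermap to the maps from the trivial system. -/
def prep {x : Type*} (σ : Matrix x x ℂ) : OpMap x x →ₗ[ℂ] OpMap Unit x where
  toFun N :=
    { toFun := fun c => c () () • N σ
      map_add' := fun c d => by rw [Matrix.add_apply, add_smul]
      map_smul' := fun t c => by rw [Matrix.smul_apply, smul_assoc, RingHom.id_apply] }
  map_add' N L := by
    refine LinearMap.ext fun c => ?_
    simp [smul_add]
  map_smul' t N := by
    refine LinearMap.ext fun c => ?_
    exact smul_comm (c () ()) t (N σ)

/-- A map on `A ⊗ B` is compatible with `T_B[W]` when `(id_A ⊗ 𝔗[W])(N)` is a channel. -/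
def IsCompatibleMap {a b : Type*} [Fintype a] [DecidableEq a] [Fintype b] [DecidableEq b]
    (W : Matrix (b × b) (b × b) ℂ) (N : OpMap (a × b) (a × b)) : Prop :=
  IsChannel (superTensor (genTranspose W) N)

/-- The preparation of `σ` is compatible with `T[W]` when `𝔓^σ ∘ 𝔗[W†]` is a superchannel. -/
def IsCompatibleState {b : Type*} [Fintype b] [DecidableEq b]
    (W : Matrix (b × b) (b × b) ℂ) (σ : Matrix b b ℂ) : Prop :=
  IsSuperchannel (prep σ ∘ₗ genTranspose Wᴴ)

/-- The trace norm `‖X‖₁ = Tr √(X†X)`. -/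
def traceNorm {x : Type*} [Fintype x] [DecidableEq x] (X : Matrix x x ℂ) : ℝ :=
  (CFC.sqrt (Xᴴ * X)).trace.re

/-- The Uhlmann fidelity `F(ρ, σ) = ‖√ρ √σ‖₁²`. -/
def fidelity {x : Type*} [Fintype x] [DecidableEq x] (ρ σ : Matrix x x ℂ) : ℝ :=
  traceNorm (CFC.sqrt ρ * CFC.sqrt σ) ^ 2

/-- The sine metric `d_S(ρ, σ) = √(1 - F(ρ, σ))`. -/
def sineDist {x : Type*} [Fintype x] [DecidableEq x] (ρ σ : Matrix x x ℂ) : ℝ :=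
  √(1 - fidelity ρ σ)

/-- The map `ρ ↦ Tr_A[N(ρ ⊗ σ)]` from operators on `A` to operators on `B`. -/
def reducedMap {a b : Type*} [Fintype a] (N : OpMap (a × b) (a × b)) (σ : Matrix b b ℂ) :
    OpMap a b where
  toFun ρ := traceFst (N (ρ ⊗ₖ σ))
  map_add' ρ τ := by
    rw [Matrix.add_kronecker, map_add]
    exact Finset.sum_add_distrib
  map_smul' c ρ := by
    rw [Matrix.smul_kronecker, map_smul]
    change ∑ i, c • opBlock (N (ρ ⊗ₖ σ)) i i = c • ∑ i, opBlock (N (ρ ⊗ₖ σ)) i i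
    rw [Finset.smul_sum]

/-- The information destruction `D_S(N)`: the minimal sine metric between the Choi matrix of `N`
and that of a unitary operation `Ad_Y`, `Y : A → B` unitary (for `|A| = |B|`). -/
def infoDestruction {a b : Type*} [Fintype a] [DecidableEq a] [Fintype b] [DecidableEq b]
    (N : OpMap a b) : ℝ :=
  ⨅ Y : {Y : Matrix b a ℂ // Yᴴ * Y = 1 ∧ Y * Yᴴ = 1}, sineDist (choi N) (choi (Ad Y.1))

/-- The information non-leakage `K_{B⟨A}(N|σ) = D_S(Tr_A[N(· ⊗ σ)])`. -/
def nonLeakage {a b : Type*} [Fintype a] [DecidableEq a] [Fintype b] [DecidableEq b]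
    (N : OpMap (a × b) (a × b)) (σ : Matrix b b ℂ) : ℝ :=
  infoDestruction (reducedMap N σ)

/-- The non-catalyticity
`D_{B⟨A}(N|σ) = min_ξ d_S(Tr_A[N(φ⁺_{AA'} ⊗ σᵀ_B)], π_{A'} ⊗ ξ_B)` over states `ξ` on `B`. The first
argument of `d_S` is the Choi matrix of `ρ ↦ Tr_A[N(ρ ⊗ σᵀ)]`; the factors are ordered `B, A'`. -/
def nonCatalyticity {a b : Type*} [Fintype a] [DecidableEq a] [Fintype b] [DecidableEq b]
    (N : OpMap (a × b) (a × b)) (σ : Matrix b b ℂ) : ℝ :=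
  ⨅ ξ : {ξ : Matrix b b ℂ // IsState ξ},
    sineDist (choi (reducedMap N σᵀ)) (ξ.1 ⊗ₖ ((Fintype.card a : ℂ)⁻¹ • (1 : Matrix a a ℂ)))

end

end QTime

namespace QTime

/-! Both distances compare Choi matrices, so the theorem reduces to two fidelities. Compatibility of
`σ` forces `W (1 ⊗ σᵀ) W† = 1 ⊗ τ` for a state `τ` (`IsCompatibleState.exists_state`), and this `τ`
serves as the `ξ` in the non-catalyticity. For a unitary `Y`, the fidelity inside the non-leakage is
`c = Tr(L L† σᵀ)`, where `L` is the overlap of `U` with the entrywise conjugate of `Y`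
(`fidelity_choi_Ad`). It remains to show that the fidelity for `W` and `τ` is at least `c²`: then `1
- c² ≤ 2(1 - c)` gives the bound.

The estimate `c²` (`sq_le_fidelity_choi_reducedMap`) is the easy half of Uhlmann's theorem: any `X`,
`Z` with `X X† ≤ ρ` and `Z Z† ≤ τ'` satisfy `|Tr X†Z|² ≤ F(ρ, τ')`. Here `X` is built from `W` and
`√σᵀ Q`, with `Q` the polar part of `L`, while `Z` is built from `√τ`, the conjugate of `Y`, and the
transposed unitary `W * realign U`. Compatibility of `U` makes a partial transpose of `W * realign
U` a coisometry, so `Z Z† = τ ⊗ π`. As `W` intertwines `1 ⊗ √σᵀ` with `1 ⊗ √τ`, it occurs in `X` and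
in `Z` and cancels in the overlap, leaving `Tr(√(L L†) σᵀ)`. This is at least `c` because `L` is a
contraction. -/

/-! ### Square roots, trace norm and fidelity -/

/-- A Hermitian matrix has a Hermitian `g` inverting it on its range. -/
theorem exists_hermitian_pseudoinverse {n : Type*} [Fintype n] [DecidableEq n]
    (s : Matrix n n ℂ) (hs : s.IsHermitian) :
    ∃ g : Matrix n n ℂ, gᴴ = g ∧ s * s * g = s := by
  have hs' : IsSelfAdjoint s := hs
  have hfin : (spectrum ℝ s).Finite := Matrix.finite_real_spectrum
  have hc : ∀ f : ℝ → ℝ, ContinuousOn f (spectrum ℝ s) := fun f =>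
    hfin.continuousOn f
  refine ⟨cfc (fun x : ℝ => x⁻¹) s, ?_, ?_⟩
  · exact (cfc_predicate (R := ℝ) (fun x : ℝ => x⁻¹) s : IsSelfAdjoint _)
  · have h1 : s * s = cfc (fun x : ℝ => x * x) s := by
      rw [cfc_mul (fun x : ℝ => x) (fun x : ℝ => x) s (hc _) (hc _), cfc_id' ℝ s]
    rw [h1, ← cfc_mul _ _ s (hc _) (hc _)]
    conv_rhs => rw [← cfc_id' ℝ s]
    congr 1
    funext x
    by_cases hx : x = 0 <;> simp [hx]

theorem sqrt_isHermitian {n : Type*} [Fintype n] [DecidableEq n] (ρ : Matrix n n ℂ) :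
    (CFC.sqrt ρ)ᴴ = CFC.sqrt ρ :=
  (Matrix.nonneg_iff_posSemidef.mp (CFC.sqrt_nonneg ρ)).isHermitian

theorem sqrt_mul_sqrt {n : Type*} [Fintype n] [DecidableEq n] {ρ : Matrix n n ℂ}
    (hρ : ρ.PosSemidef) : CFC.sqrt ρ * CFC.sqrt ρ = ρ :=
  CFC.sqrt_mul_sqrt_self ρ (Matrix.nonneg_iff_posSemidef.mpr hρ)

/-- A factor of an operator below `ρ` is `√ρ` times a contraction. -/
theorem exists_eq_sqrt_mul {n m : Type*} [Fintype n] [DecidableEq n] [Fintype m]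
    {ρ : Matrix n n ℂ} (hρ : ρ.PosSemidef) (X : Matrix n m ℂ) (hX : X * Xᴴ ≤ ρ) :
    ∃ C : Matrix n m ℂ, X = CFC.sqrt ρ * C ∧ C * Cᴴ ≤ 1 ∧
      (X * Xᴴ = ρ → X * Cᴴ = CFC.sqrt ρ) := by
  have hsH := sqrt_isHermitian ρ
  have hss := sqrt_mul_sqrt hρ
  obtain ⟨g, hg, hsg⟩ := exists_hermitian_pseudoinverse _ hsH
  set s := CFC.sqrt ρ
  have hgs : g * (s * s) = s := by
    have := congrArg Matrix.conjTranspose hsg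
    simpa [Matrix.conjTranspose_mul, hg, hsH] using this
  have hcomm : s * g = g * s := by
    calc s * g = g * (s * s) * g := by rw [hgs]
      _ = g * (s * s * g) := by simp only [Matrix.mul_assoc]
      _ = g * s := by rw [hsg]
  -- `s * g` is the support projection of `ρ`; the contraction will be `g * X`.
  have heH : (s * g)ᴴ = s * g := by rw [Matrix.conjTranspose_mul, hg, hsH, hcomm]
  have hes : s * g * s = s := by rw [hcomm, Matrix.mul_assoc, hgs]
  have heρ : s * g * ρ = ρ := by rw [← hss, ← Matrix.mul_assoc, hes]
  have hee : s * g * (s * g) = s * g := by rw [← Matrix.mul_assoc, hes]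
  have hX' := Matrix.le_iff.mp hX
  refine ⟨g * X, ?_, ?_, ?_⟩
  -- Off the support of `ρ`, the positive operator `ρ - X X†` compresses to `-X X†`, so that
  -- compression vanishes.
  · have h0 : (1 - s * g) * X = 0 := by
      rw [← Matrix.self_mul_conjTranspose_eq_zero]
      have h1 := hX'.mul_mul_conjTranspose_same (1 - s * g)
      have h2 : (1 - s * g) * (ρ - X * Xᴴ) * (1 - s * g)ᴴ
          = -((1 - s * g) * X * ((1 - s * g) * X)ᴴ) := by
        rw [Matrix.mul_sub, Matrix.sub_mul 1 (s * g) ρ, heρ, Matrix.one_mul, sub_self, zero_sub,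
          Matrix.neg_mul, Matrix.conjTranspose_mul]
        simp only [Matrix.mul_assoc]
      rw [h2] at h1
      have h3 := Matrix.posSemidef_self_mul_conjTranspose ((1 - s * g) * X)
      exact le_antisymm (neg_nonneg.mp (Matrix.nonneg_iff_posSemidef.mpr h1))
        (Matrix.nonneg_iff_posSemidef.mpr h3)
    rw [Matrix.sub_mul, Matrix.one_mul, sub_eq_zero] at h0
    rw [← Matrix.mul_assoc]; exact h0
  · have h1 := Matrix.nonneg_iff_posSemidef.mpr (hX'.mul_mul_conjTranspose_same g)
    have h2 := Matrix.nonneg_iff_posSemidef.mpr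
      (Matrix.posSemidef_self_mul_conjTranspose (1 - s * g))
    have h3 : (1 - s * g) * (1 - s * g)ᴴ = 1 - s * g := by
      rw [Matrix.conjTranspose_sub, heH, Matrix.conjTranspose_one, Matrix.mul_sub,
        Matrix.sub_mul 1 (s * g) (s * g), hee]; simp
    have h4 : g * (ρ - X * Xᴴ) * gᴴ = s * g - g * X * (g * X)ᴴ := by
      rw [Matrix.mul_sub, Matrix.sub_mul, ← hss, hgs, hg, Matrix.conjTranspose_mul, hg]
      simp only [Matrix.mul_assoc]
    rw [h4] at h1
    rw [h3] at h2
    exact (sub_nonneg.mp h1).trans (sub_nonneg.mp h2)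
  · intro h
    rw [Matrix.conjTranspose_mul, hg, ← Matrix.mul_assoc, h, ← hss, hsg]

theorem sum_norm_sq_eq_trace {n m : Type*} [Fintype n] [Fintype m] (X : Matrix n m ℂ) :
    ((∑ i, ∑ j, ‖X i j‖ ^ 2 : ℝ) : ℂ) = (X * Xᴴ).trace := by
  simp only [Matrix.trace, Matrix.diag, Matrix.mul_apply, Matrix.conjTranspose_apply,
    Complex.ofReal_sum]
  refine Finset.sum_congr rfl fun i _ => Finset.sum_congr rfl fun j _ => ?_
  rw [Complex.star_def, Complex.mul_conj, Complex.normSq_eq_norm_sq]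

theorem norm_trace_conjTranspose_mul_sq_le {n m : Type*} [Fintype n] [Fintype m]
    (X Z : Matrix n m ℂ) :
    ‖(Xᴴ * Z).trace‖ ^ 2 ≤ (X * Xᴴ).trace.re * (Z * Zᴴ).trace.re := by
  rw [← sum_norm_sq_eq_trace, ← sum_norm_sq_eq_trace, Complex.ofReal_re, Complex.ofReal_re]
  have h : ‖(Xᴴ * Z).trace‖ ≤ ∑ p : n × m, ‖X p.1 p.2‖ * ‖Z p.1 p.2‖ := by
    rw [Matrix.trace_mul_comm, Fintype.sum_prod_type]
    simp only [Matrix.trace, Matrix.diag, Matrix.mul_apply, Matrix.conjTranspose_apply]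
    refine (norm_sum_le _ _).trans (Finset.sum_le_sum fun i _ => ?_)
    refine (norm_sum_le _ _).trans (Finset.sum_le_sum fun j _ => ?_)
    rw [norm_mul, norm_star, mul_comm]
  have h2 := Finset.sum_mul_sq_le_sq_mul_sq Finset.univ
    (fun p : n × m => ‖X p.1 p.2‖) (fun p => ‖Z p.1 p.2‖)
  rw [Fintype.sum_prod_type (f := fun p : n × m => ‖X p.1 p.2‖ ^ 2),
    Fintype.sum_prod_type (f := fun p : n × m => ‖Z p.1 p.2‖ ^ 2)] at h2
  exact (pow_le_pow_left₀ (norm_nonneg _) h 2).trans h2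

theorem trace_re_mono {n : Type*} [Fintype n] {A B : Matrix n n ℂ} (h : A ≤ B) :
    A.trace.re ≤ B.trace.re := by
  have := (Matrix.le_iff.mp h).trace_nonneg
  rw [Matrix.trace_sub] at this
  have := (Complex.le_def.mp this).1
  simpa using this

theorem mul_mul_conjTranspose_mono {n m : Type*} [Fintype n] [Fintype m] {A B : Matrix n n ℂ}
    (h : A ≤ B) (C : Matrix m n ℂ) : C * A * Cᴴ ≤ C * B * Cᴴ := by
  rw [Matrix.le_iff] at h ⊢
  have := h.mul_mul_conjTranspose_same C
  rwa [Matrix.mul_sub, Matrix.sub_mul] at this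

/-- The duality between the trace norm and contractions, in factorized form. -/
theorem norm_trace_mul_le_traceNorm {n m : Type*} [Fintype n] [DecidableEq n] [Fintype m]
    (T : Matrix n n ℂ) (C D : Matrix n m ℂ) (hC : C * Cᴴ ≤ 1) (hD : D * Dᴴ ≤ 1) :
    ‖(Cᴴ * T * D).trace‖ ≤ traceNorm T := by
  have hP : (Tᴴ * T).PosSemidef := Matrix.posSemidef_conjTranspose_mul_self T
  -- Polar decomposition `T = E† |T|`. With `B = √|T|`, the trace is the Hilbert–Schmidt product of
  -- `B E C` and `B D`, both of squared norm at most `Tr |T|`, so Cauchy–Schwarz finishes.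
  obtain ⟨E, hTE, hE, -⟩ := exists_eq_sqrt_mul hP Tᴴ (by rw [Matrix.conjTranspose_conjTranspose])
  unfold traceNorm
  have hA : (CFC.sqrt (Tᴴ * T)).PosSemidef :=
    Matrix.nonneg_iff_posSemidef.mp (CFC.sqrt_nonneg _)
  set A := CFC.sqrt (Tᴴ * T)
  have hT : T = Eᴴ * A := by
    rw [← Matrix.conjTranspose_conjTranspose T, hTE, Matrix.conjTranspose_mul,
      hA.isHermitian.eq]
  have hB := sqrt_mul_sqrt hA
  have hBH := sqrt_isHermitian A
  set B := CFC.sqrt A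
  have key := norm_trace_conjTranspose_mul_sq_le (B * (E * C)) (B * D)
  have e1 : (B * (E * C))ᴴ * (B * D) = Cᴴ * T * D := by
    rw [hT, ← hB]; simp only [Matrix.conjTranspose_mul, hBH, Matrix.mul_assoc]
  have hbound : ∀ G : Matrix n m ℂ, G * Gᴴ ≤ 1 →
      (B * G * (B * G)ᴴ).trace.re ≤ A.trace.re := by
    intro G hG
    have := trace_re_mono (mul_mul_conjTranspose_mono hG B)
    rw [Matrix.mul_one, hBH, hB] at this
    rw [Matrix.conjTranspose_mul, hBH]
    simpa only [Matrix.mul_assoc] using this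
  have hEC : E * C * (E * C)ᴴ ≤ 1 := by
    have := mul_mul_conjTranspose_mono hC E
    rw [Matrix.mul_one] at this
    rw [Matrix.conjTranspose_mul]
    refine le_trans ?_ (this.trans hE)
    simp only [Matrix.mul_assoc, le_refl]
  have h0 : 0 ≤ A.trace.re := (Complex.le_def.mp hA.trace_nonneg).1
  rw [e1] at key
  have h1 := hbound _ hEC
  have h2 := hbound _ hD
  have h3 : 0 ≤ (B * D * (B * D)ᴴ).trace.re :=
    (Complex.le_def.mp (Matrix.posSemidef_self_mul_conjTranspose (B * D)).trace_nonneg).1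
  refine abs_le_of_sq_le_sq' ?_ h0 |>.2
  calc _ ≤ _ := key
    _ ≤ A.trace.re * A.trace.re := mul_le_mul h1 h2 h3 h0
    _ = _ := by ring

/-- The overlap of (sub-)purifications bounds the fidelity from below. -/
theorem norm_trace_sq_le_fidelity {n m : Type*} [Fintype n] [DecidableEq n] [Fintype m]
    {ρ τ : Matrix n n ℂ} (hρ : ρ.PosSemidef) (hτ : τ.PosSemidef) (X Z : Matrix n m ℂ)
    (hX : X * Xᴴ ≤ ρ) (hZ : Z * Zᴴ ≤ τ) : ‖(Xᴴ * Z).trace‖ ^ 2 ≤ fidelity ρ τ := by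
  obtain ⟨C, hXC, hC, -⟩ := exists_eq_sqrt_mul hρ X hX
  obtain ⟨D, hZD, hD, -⟩ := exists_eq_sqrt_mul hτ Z hZ
  unfold fidelity
  refine pow_le_pow_left₀ (norm_nonneg _) ?_ 2
  have := norm_trace_mul_le_traceNorm (CFC.sqrt ρ * CFC.sqrt τ) C D hC hD
  rwa [show Xᴴ * Z = Cᴴ * (CFC.sqrt ρ * CFC.sqrt τ) * D by
    rw [hXC, hZD, Matrix.conjTranspose_mul, sqrt_isHermitian]; simp only [Matrix.mul_assoc]]

/-- Fidelity with a pure state. -/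
theorem fidelity_vecMulVec {n : Type*} [Fintype n] [DecidableEq n] {ρ : Matrix n n ℂ}
    (hρ : ρ.PosSemidef) (η : n → ℂ) (hη : star η ⬝ᵥ η = 1) :
    fidelity ρ (Matrix.vecMulVec η (star η)) = (star η ⬝ᵥ ρ *ᵥ η).re := by
  set P := Matrix.vecMulVec η (star η) with hP
  have hPP : P * P = P := by
    rw [hP, Matrix.vecMulVec_mul_vecMulVec, hη]; simp
  have hPps : P.PosSemidef := Matrix.posSemidef_vecMulVec_self_star η
  have hsqrtP : CFC.sqrt P = P :=
    CFC.sqrt_unique hPP (Matrix.nonneg_iff_posSemidef.mpr hPps)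
  have hc := hρ.dotProduct_mulVec_nonneg η
  obtain ⟨hc0, hcim⟩ := Complex.le_def.mp hc
  set c := star η ⬝ᵥ ρ *ᵥ η with hcdef
  have hcre : c = ((c.re : ℝ) : ℂ) := Complex.ext rfl (by simpa using hcim.symm)
  have hPtr : P.trace = 1 := by
    rw [hP, Matrix.trace_vecMulVec, dotProduct_comm, hη]
  have h1 : P * ρ * P = c • P := by
    ext i j
    simp only [hP, hcdef, Matrix.mul_apply, Matrix.vecMulVec_apply, dotProduct, Matrix.mulVec,
      Matrix.smul_apply, smul_eq_mul, Finset.sum_mul, Finset.mul_sum]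
    rw [Finset.sum_comm]
    refine Finset.sum_congr rfl fun k _ => Finset.sum_congr rfl fun l _ => ?_
    ring
  unfold fidelity traceNorm
  rw [hsqrtP]
  -- A projection is its own square root, so the trace norm only involves `P ρ P = c P`, whose root
  -- is `√c P`.
  have h2 : (CFC.sqrt ρ * P)ᴴ * (CFC.sqrt ρ * P) = c • P := by
    rw [Matrix.conjTranspose_mul, sqrt_isHermitian, hPps.isHermitian.eq, ← h1]
    conv_rhs => rw [← sqrt_mul_sqrt hρ]
    simp only [Matrix.mul_assoc]
  have h3 : CFC.sqrt (c • P) = ((√c.re : ℝ) : ℂ) • P := by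
    refine CFC.sqrt_unique ?_ (Matrix.nonneg_iff_posSemidef.mpr ?_)
    · rw [Matrix.smul_mul, Matrix.mul_smul, hPP, smul_smul, ← Complex.ofReal_mul,
        Real.mul_self_sqrt (by simpa using hc0), ← hcre]
    · exact hPps.smul (by simp [Complex.le_def, Real.sqrt_nonneg])
  rw [h2, h3, Matrix.trace_smul, hPtr]
  simp [Real.sq_sqrt (by simpa using hc0 : (0:ℝ) ≤ c.re)]

/-! ### Compatible states -/

theorem eq_zero_of_forall_star_dotProduct_mulVec {n : Type*} [Fintype n] [DecidableEq n]
    (M : Matrix n n ℂ) (h : ∀ v : n → ℂ, star v ⬝ᵥ M *ᵥ v = 0) : M = 0 := by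
  have h1 : Matrix.toEuclideanLin M = 0 := by
    rw [← inner_map_self_eq_zero]
    intro x
    have h2 := h x.ofLp
    rw [EuclideanSpace.inner_eq_star_dotProduct]
    have h3 := congrArg star h2
    rw [← Matrix.star_dotProduct_star, star_star, star_zero] at h3
    rw [dotProduct_comm]
    exact h3
  exact (LinearEquiv.map_eq_zero_iff _).mp h1

theorem exists_unit_smul {n : Type*} [Fintype n] [DecidableEq n] [Nonempty n] (v : n → ℂ) :
    ∃ (r : ℝ) (u : n → ℂ), star u ⬝ᵥ u = 1 ∧ v = (r : ℂ) • u := by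
  by_cases hv : v = 0
  · refine ⟨0, Pi.single (Classical.arbitrary n) 1, by simp, by simp [hv]⟩
  · have hpos : 0 < star v ⬝ᵥ v := Matrix.dotProduct_star_self_pos_iff.mpr hv
    obtain ⟨hre, him⟩ := Complex.lt_def.mp hpos
    have heq : star v ⬝ᵥ v = (((star v ⬝ᵥ v).re : ℝ) : ℂ) :=
      Complex.ext rfl (by simpa using him.symm)
    set c := (star v ⬝ᵥ v).re
    have hc : (0 : ℝ) < c := by simpa using hre
    have hs : (√c : ℂ) ≠ 0 := by exact_mod_cast (Real.sqrt_pos.mpr hc).ne'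
    refine ⟨√c, (√c : ℂ)⁻¹ • v, ?_, ?_⟩
    · rw [star_smul, smul_dotProduct, dotProduct_smul, heq]
      have h2 : (c : ℂ) = (√c : ℂ) * (√c : ℂ) := by
        rw [← Complex.ofReal_mul, Real.mul_self_sqrt hc.le]
      simp only [smul_eq_mul, star_inv₀, Complex.star_def, Complex.conj_ofReal]
      rw [h2]; field_simp
    · rw [smul_smul, mul_inv_cancel₀ hs, one_smul]

theorem Ad_isCompletelyPositive {x y : Type*} [Fintype x] [Fintype y] (A : Matrix y x ℂ) :
    IsCompletelyPositive (Ad A) := by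
  intro k M hM
  have h := hM.mul_mul_conjTranspose_same ((1 : Matrix (Fin k) (Fin k) ℂ) ⊗ₖ A)
  convert h using 1
  ext ⟨p, i⟩ ⟨q, j⟩
  simp only [Ad, Matrix.mul_apply, opBlock, Fintype.sum_prod_type, Matrix.one_apply, ite_mul,
    LinearMap.coe_mk, AddHom.coe_mk, Matrix.of_apply, Matrix.kroneckerMap_apply, one_mul, zero_mul,
    Matrix.conjTranspose_apply, Finset.sum_ite_irrel, Finset.sum_const_zero, Finset.sum_ite_eq,
    Finset.mem_univ, if_true, apply_ite star, star_zero, mul_ite, mul_zero]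

theorem isChannel_Ad_add_Ad {x : Type*} [Fintype x] [DecidableEq x] (A R : Matrix x x ℂ)
    (h : Aᴴ * A + Rᴴ * R = 1) : IsChannel (Ad A + Ad R) := by
  constructor
  · intro k M hM
    exact (Ad_isCompletelyPositive A k M hM).add (Ad_isCompletelyPositive R k M hM)
  · intro ρ
    change (A * ρ * Aᴴ + R * ρ * Rᴴ).trace = ρ.trace
    rw [Matrix.trace_add, Matrix.mul_assoc, Matrix.mul_assoc, Matrix.trace_mul_comm,
      Matrix.trace_mul_comm R, Matrix.mul_assoc, Matrix.mul_assoc, ← Matrix.trace_add,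
      ← Matrix.mul_add, h, Matrix.mul_one]

/-- Moves `W` from the Choi matrix to the state, so that trace preservation becomes a condition on
the single operator `W (1 ⊗ σᵀ) W†`. -/
theorem trace_ofChoi {b : Type*} [Fintype b] [DecidableEq b] (W C : Matrix (b × b) (b × b) ℂ)
    (σ : Matrix b b ℂ) :
    (ofChoi (Wᴴ * C * W) σ).trace
      = (Fintype.card b : ℂ) * (C * (W * ((1 : Matrix b b ℂ) ⊗ₖ σᵀ) * Wᴴ)).trace := by
  have h1 : (C * (W * ((1 : Matrix b b ℂ) ⊗ₖ σᵀ) * Wᴴ)).trace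
      = ((Wᴴ * C * W) * ((1 : Matrix b b ℂ) ⊗ₖ σᵀ)).trace := by
    rw [← Matrix.mul_assoc, Matrix.trace_mul_comm]
    simp only [Matrix.mul_assoc]
  rw [h1]
  generalize Wᴴ * C * W = Y
  simp only [ofChoi, LinearMap.coe_mk, AddHom.coe_mk, Matrix.trace, Matrix.diag, Matrix.of_apply,
    Matrix.mul_apply, Matrix.kroneckerMap_apply, Matrix.transpose_apply, Fintype.sum_prod_type,
    Matrix.one_apply, ite_mul, one_mul, zero_mul, mul_ite, mul_zero, ← Finset.mul_sum]
  congr 1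
  refine Finset.sum_congr rfl fun i _ => Finset.sum_congr rfl fun k _ => ?_
  rw [Finset.sum_comm]
  refine Finset.sum_congr rfl fun l _ => ?_
  simp [mul_comm]

/-- The vectorization of an operator, output factor first. -/
def vec {x y : Type*} (A : Matrix y x ℂ) : y × x → ℂ := fun p => A p.1 p.2

theorem choi_Ad {x y : Type*} [Fintype x] [DecidableEq x] (A : Matrix y x ℂ) :
    choi (Ad A) = (Fintype.card x : ℂ)⁻¹ • Matrix.vecMulVec (vec A) (star (vec A)) := by
  ext ⟨i, k⟩ ⟨j, l⟩
  simp [choi, Ad, vec, Matrix.vecMulVec_apply, Matrix.mul_apply, Matrix.single_apply, ite_and,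
    Finset.sum_ite_eq]

/-- The channel with Kraus operators `A`, `R` must be sent to the preparation of a trace-one
operator. Each Choi matrix is rank one, so each Kraus operator contributes a quadratic form at its
vectorization. -/
theorem IsCompatibleState.quadratic_form_add {b : Type*} [Fintype b] [DecidableEq b] [Nonempty b]
    {W : Matrix (b × b) (b × b) ℂ} {σ : Matrix b b ℂ} (hσW : IsCompatibleState W σ)
    (A R : Matrix b b ℂ) (h : Aᴴ * A + Rᴴ * R = 1) :
    star (vec A) ⬝ᵥ (W * ((1 : Matrix b b ℂ) ⊗ₖ σᵀ) * Wᴴ) *ᵥ vec A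
      + star (vec R) ⬝ᵥ (W * ((1 : Matrix b b ℂ) ⊗ₖ σᵀ) * Wᴴ) *ᵥ vec R = 1 := by
  -- The superchannel condition is only tested with trivial auxiliary systems.
  set A' : Matrix (Fin 1 × b) (Fin 1 × b) ℂ := A.submatrix Prod.snd Prod.snd with hA'
  set R' : Matrix (Fin 1 × b) (Fin 1 × b) ℂ := R.submatrix Prod.snd Prod.snd with hR'
  have hch : IsChannel (Ad A' + Ad R') := by
    refine isChannel_Ad_add_Ad A' R' ?_
    ext ⟨p, i⟩ ⟨q, j⟩
    have h' := congrFun (congrFun h i) j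
    obtain rfl := Subsingleton.elim p q
    simpa [hA', hR', Matrix.mul_apply, Fintype.sum_prod_type, Matrix.one_apply] using h'
  have hblock : mapBlock (Ad A' + Ad R') 0 0 0 0 = Ad A + Ad R := by
    refine LinearMap.ext fun ρ => ?_
    ext i j
    simp [mapBlock, opBlock, Ad, hA', hR', Matrix.mul_apply, Fintype.sum_prod_type]
  have h1 := (hσW 1 1 _ hch).2 1
  have h2 : (genTranspose Wᴴ (Ad A + Ad R) σ).trace = 1 := by
    simpa [Matrix.trace, superTensor, prep, opBlock, Fintype.sum_prod_type, hblock] using h1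
  have hd : (Fintype.card b : ℂ) ≠ 0 := by simp
  have hq : ∀ M : Matrix b b ℂ, (genTranspose Wᴴ (Ad M) σ).trace
      = star (vec M) ⬝ᵥ (W * ((1 : Matrix b b ℂ) ⊗ₖ σᵀ) * Wᴴ) *ᵥ vec M := by
    intro M
    have := trace_ofChoi W (choi (Ad M)) σ
    change (ofChoi (Wᴴ * choi (Ad M) * Wᴴᴴ) σ).trace = _
    rw [Matrix.conjTranspose_conjTranspose, this, choi_Ad, Matrix.smul_mul, Matrix.trace_smul,
      smul_eq_mul, ← mul_assoc, mul_inv_cancel₀ hd, one_mul, Matrix.vecMulVec_mul,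
      Matrix.trace_vecMulVec, dotProduct_comm, Matrix.dotProduct_mulVec]
  rw [map_add, LinearMap.add_apply, Matrix.trace_add, hq, hq] at h2
  exact h2

/-- The operator `W (1 ⊗ σᵀ) W†` of a compatible state is trivial on the output factor. -/
theorem IsCompatibleState.exists_state {b : Type*} [Fintype b] [DecidableEq b] [Nonempty b]
    {W : Matrix (b × b) (b × b) ℂ} (hW : W ∈ Matrix.unitaryGroup (b × b) ℂ) {σ : Matrix b b ℂ}
    (hσ : IsState σ) (hσW : IsCompatibleState W σ) :
    ∃ τ : Matrix b b ℂ, IsState τ ∧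
      W * ((1 : Matrix b b ℂ) ⊗ₖ σᵀ) * Wᴴ = (1 : Matrix b b ℂ) ⊗ₖ τ := by
  have hform := hσW.quadratic_form_add
  have hXps : (W * ((1 : Matrix b b ℂ) ⊗ₖ σᵀ) * Wᴴ).PosSemidef :=
    (Matrix.PosSemidef.one.kronecker hσ.1.transpose).mul_mul_conjTranspose_same W
  have hXtr : (W * ((1 : Matrix b b ℂ) ⊗ₖ σᵀ) * Wᴴ).trace = Fintype.card b := by
    rw [Matrix.trace_mul_comm, ← Matrix.mul_assoc, ← Matrix.star_eq_conjTranspose,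
      Matrix.mem_unitaryGroup_iff'.mp hW, Matrix.one_mul, Matrix.trace_kronecker, Matrix.trace_one,
      Matrix.trace_transpose, hσ.2, mul_one]
  set X := W * ((1 : Matrix b b ℂ) ⊗ₖ σᵀ) * Wᴴ
  let i₀ : b := Classical.arbitrary b
  let q : (b → ℂ) → (b → ℂ) → ℂ := fun w v =>
    star (vec (Matrix.vecMulVec w (star v))) ⬝ᵥ X *ᵥ vec (Matrix.vecMulVec w (star v))
  let e₀ : b → ℂ := Pi.single i₀ 1
  have he₀ : star e₀ ⬝ᵥ e₀ = 1 := by simp [e₀]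
  -- `|w⟩⟨v|` and `|w'⟩⟨v|` are completed to a channel by the same Kraus operator `1 - |v⟩⟨v|`, so
  -- their quadratic forms agree.
  have hunit : ∀ v w w' : b → ℂ, star v ⬝ᵥ v = 1 → star w ⬝ᵥ w = 1 → star w' ⬝ᵥ w' = 1 →
      q w v = q w' v := by
    intro v w w' hv hw hw'
    have hvv : (1 - Matrix.vecMulVec v (star v))ᴴ * (1 - Matrix.vecMulVec v (star v))
        = 1 - Matrix.vecMulVec v (star v) := by
      rw [Matrix.conjTranspose_sub, Matrix.conjTranspose_one, Matrix.conjTranspose_vecMulVec,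
        star_star, Matrix.mul_sub, Matrix.sub_mul 1 _ (Matrix.vecMulVec v (star v)),
        Matrix.vecMulVec_mul_vecMulVec, hv]
      simp
    have key : ∀ u : b → ℂ, star u ⬝ᵥ u = 1 →
        (Matrix.vecMulVec u (star v))ᴴ * Matrix.vecMulVec u (star v)
          + (1 - Matrix.vecMulVec v (star v))ᴴ * (1 - Matrix.vecMulVec v (star v)) = 1 := by
      intro u hu
      rw [hvv, Matrix.conjTranspose_vecMulVec, star_star, Matrix.vecMulVec_mul_vecMulVec, hu]
      simp
    exact add_right_cancel ((hform _ _ (key w hw)).trans (hform _ _ (key w' hw')).symm)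
  have hscale : ∀ (r t : ℝ) (w v : b → ℂ),
      q ((r : ℂ) • w) ((t : ℂ) • v) = (r : ℂ) ^ 2 * (t : ℂ) ^ 2 * q w v := by
    intro r t w v
    have h1 : vec (Matrix.vecMulVec ((r : ℂ) • w) (star ((t : ℂ) • v)))
        = ((r : ℂ) * (t : ℂ)) • vec (Matrix.vecMulVec w (star v)) := by
      ext p
      simp [vec, Matrix.vecMulVec_apply]; ring
    simp only [q]
    rw [h1]
    simp only [star_smul, smul_dotProduct, Matrix.mulVec_smul, dotProduct_smul, smul_eq_mul,
      star_mul', Complex.star_def, Complex.conj_ofReal]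
    ring
  have hq : ∀ w v : b → ℂ, q w v = (star w ⬝ᵥ w) * q e₀ v := by
    intro w v
    obtain ⟨r, w', hw', rfl⟩ := exists_unit_smul w
    obtain ⟨t, v', hv', rfl⟩ := exists_unit_smul v
    have h2 := hscale 1 t e₀ v'
    simp only [Complex.ofReal_one, one_smul] at h2
    rw [hscale, h2, hunit v' w' e₀ hv' hw' he₀]
    simp only [star_smul, smul_dotProduct, dotProduct_smul, hw', smul_eq_mul, Complex.star_def,
      Complex.conj_ofReal]
    ring
  -- Polarization in `w` for fixed `v`. The blocks are transposed because `|w⟩⟨v|` carries the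
  -- conjugate of `v`. Polarization in `v` follows in `hblock'`.
  have hblock : ∀ v : b → ℂ,
      (Matrix.of fun i j => star v ⬝ᵥ (opBlock X i j)ᵀ *ᵥ v) = q e₀ v • (1 : Matrix b b ℂ) := by
    intro v
    rw [← sub_eq_zero]
    refine eq_zero_of_forall_star_dotProduct_mulVec _ fun w => ?_
    rw [Matrix.sub_mulVec, dotProduct_sub, Matrix.smul_mulVec, Matrix.one_mulVec, dotProduct_smul,
      smul_eq_mul, mul_comm, ← hq, sub_eq_zero]
    simp only [q, vec, dotProduct, Matrix.mulVec, Matrix.of_apply, Fintype.sum_prod_type, opBlock,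
      Matrix.vecMulVec_apply, Pi.star_apply, Matrix.transpose_apply, Finset.mul_sum,
      Finset.sum_mul, star_mul', star_star]
    refine Finset.sum_congr rfl fun i _ => ?_
    conv_rhs => rw [Finset.sum_comm]
    refine Finset.sum_congr rfl fun j _ => ?_
    conv_rhs => rw [Finset.sum_comm]
    refine Finset.sum_congr rfl fun k _ => Finset.sum_congr rfl fun l _ => ?_
    ring
  have hblock' : ∀ i j, opBlock X i j = if i = j then opBlock X i₀ i₀ else 0 := by
    intro i j
    rw [← sub_eq_zero, ← Matrix.transpose_eq_zero]
    refine eq_zero_of_forall_star_dotProduct_mulVec _ fun v => ?_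
    have h1 := congrFun (congrFun (hblock v) i) j
    have h2 := congrFun (congrFun (hblock v) i₀) i₀
    rw [Matrix.transpose_sub, Matrix.sub_mulVec, dotProduct_sub]
    by_cases hij : i = j
    · subst hij
      simp only [Matrix.of_apply, Matrix.smul_apply, Matrix.one_apply_eq] at h1 h2
      simp [h1, h2]
    · simp only [Matrix.of_apply, Matrix.smul_apply, Matrix.one_apply_ne hij, smul_zero] at h1
      simp [h1, hij]
  have hXτ : X = (1 : Matrix b b ℂ) ⊗ₖ opBlock X i₀ i₀ := by
    ext ⟨i, k⟩ ⟨j, l⟩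
    have h1 := congrFun (congrFun (hblock' i j) k) l
    change opBlock X i j k l = _
    rw [h1]
    by_cases hij : i = j <;> simp [hij]
  refine ⟨opBlock X i₀ i₀, ⟨hXps.submatrix fun k => (i₀, k), ?_⟩, hXτ⟩
  have hd : (Fintype.card b : ℂ) ≠ 0 := by simp
  rw [hXτ, Matrix.trace_kronecker, Matrix.trace_one] at hXtr
  exact mul_left_cancel₀ hd (hXtr.trans (mul_one _).symm)

/-! ### Compatible unitaries -/

/-- The realignment of an operator on `A ⊗ B` to an operator from `A ⊗ A'` to `B ⊗ B'`. -/
def realign {a b : Type*} (U : Matrix (a × b) (a × b) ℂ) : Matrix (b × b) (a × a) ℂ :=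
  Matrix.of fun p q => U (q.1, p.1) (q.2, p.2)

/-- Every block of `Ad U` has a rank-one Choi matrix made of two columns of `realign U`, so the
generalized transposition is left multiplication of `realign U` by `W`. -/
theorem genTranspose_mapBlock_Ad {a b : Type*} [Fintype a] [DecidableEq a] [Fintype b]
    [DecidableEq b] [Nonempty b] (W : Matrix (b × b) (b × b) ℂ) (U : Matrix (a × b) (a × b) ℂ)
    (p p' q q' : a) (ρ : Matrix b b ℂ) (i j : b) :
    genTranspose W (mapBlock (Ad U) p p' q q') ρ i j
      = ∑ k, ∑ l, ρ k l * ((W * realign U) (i, k) (q, p) * star ((W * realign U) (j, l) (q', p'))) := by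
  have h : choi (mapBlock (Ad U) p p' q q') = (Fintype.card b : ℂ)⁻¹ •
      Matrix.vecMulVec ((realign U).col (q, p)) (star ((realign U).col (q', p'))) := by
    ext ⟨i, k⟩ ⟨j, l⟩
    simp [choi, mapBlock, opBlock, Ad, realign, Matrix.vecMulVec_apply, Matrix.mul_apply,
      Matrix.single_apply, ite_and, Finset.sum_ite_eq, Fintype.sum_prod_type]
  have hd : (Fintype.card b : ℂ) ≠ 0 := by simp
  change ofChoi (W * choi (mapBlock (Ad U) p p' q q') * Wᴴ) ρ i j = _
  rw [h, Matrix.mul_smul, Matrix.smul_mul, Matrix.mul_vecMulVec, Matrix.vecMulVec_mul,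
    ← Matrix.star_mulVec]
  simp only [ofChoi, LinearMap.coe_mk, AddHom.coe_mk, Matrix.of_apply, Matrix.smul_apply,
    smul_eq_mul, Matrix.vecMulVec_apply, Finset.mul_sum]
  refine Finset.sum_congr rfl fun k _ => Finset.sum_congr rfl fun l _ => ?_
  rw [mul_left_comm (ρ k l), ← mul_assoc, mul_inv_cancel₀ hd, one_mul]
  rfl

/-- The partial transpose of a compatible unitary is an isometry. -/
theorem IsCompatibleMap.sum_realign {a b : Type*} [Fintype a] [DecidableEq a] [Fintype b]
    [DecidableEq b] [Nonempty b] {W : Matrix (b × b) (b × b) ℂ} {U : Matrix (a × b) (a × b) ℂ}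
    (hUW : IsCompatibleMap W (Ad U)) (p p' : a) (k l : b) :
    ∑ q, ∑ i, (W * realign U) (i, k) (q, p) * star ((W * realign U) (i, l) (q, p'))
      = if k = l ∧ p = p' then 1 else 0 := by
  -- Trace preservation on matrix units is exactly the orthonormality relation.
  have h := hUW.2 (Matrix.single (p, k) (p', l) 1)
  simp only [Matrix.trace, Matrix.diag, superTensor, LinearMap.coe_mk, AddHom.coe_mk,
    Matrix.of_apply, Fintype.sum_prod_type, genTranspose_mapBlock_Ad, opBlock,
    Matrix.single_apply, Prod.mk.injEq, ite_and, ite_mul, one_mul, zero_mul, Finset.sum_ite_eq,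
    Finset.mem_univ, if_true] at h
  simp only [Finset.sum_ite_irrel, Finset.sum_const_zero, Finset.sum_ite_eq, Finset.mem_univ,
    if_true] at h
  refine h.trans ?_
  by_cases hp : p = p' <;> by_cases hk : k = l <;> simp [hp, hk, eq_comm]

/-! ### Contractions and the operator order -/

section Contraction
open scoped Matrix.Norms.L2Operator

theorem norm_le_one_of_conjTranspose_mul_self {m n : Type*} [Fintype m] [Fintype n]
    [DecidableEq n] {A : Matrix m n ℂ} (h : Aᴴ * A = 1) : ‖A‖ ≤ 1 := by
  have h1 := Matrix.l2_opNorm_conjTranspose_mul_self A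
  have h2 : ‖(1 : Matrix n n ℂ)‖ ≤ 1 := by
    rw [← Matrix.diagonal_one, Matrix.l2_opNorm_diagonal]
    exact (pi_norm_const_le (1 : ℂ)).trans (by simp)
  rw [h] at h1
  nlinarith [norm_nonneg A]

theorem norm_le_one_of_self_mul_conjTranspose {m n : Type*} [Fintype m] [Fintype n]
    [DecidableEq m] [DecidableEq n] {A : Matrix m n ℂ} (h : A * Aᴴ = 1) : ‖A‖ ≤ 1 := by
  rw [← Matrix.l2_opNorm_conjTranspose]
  exact norm_le_one_of_conjTranspose_mul_self (by rwa [Matrix.conjTranspose_conjTranspose])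

theorem self_mul_conjTranspose_le_one {m n : Type*} [Fintype m] [Fintype n]
    [DecidableEq m] [DecidableEq n] {A : Matrix m n ℂ} (h : ‖A‖ ≤ 1) : A * Aᴴ ≤ 1 := by
  have h1 : ‖A * Aᴴ‖ ≤ 1 := by
    refine (Matrix.l2_opNorm_mul A Aᴴ).trans ?_
    rw [Matrix.l2_opNorm_conjTranspose]
    nlinarith [norm_nonneg A]
  exact (CStarAlgebra.norm_le_one_iff_of_nonneg (A * Aᴴ)
    (Matrix.nonneg_iff_posSemidef.mpr (Matrix.posSemidef_self_mul_conjTranspose A))).mp h1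

/-- The operator `L : A → B` with `L_{kc} = |A|⁻¹ ∑ y_{m p} U_{(c,m),(p,k)}`: the overlap of the
realigned `U` with `y`. -/
noncomputable def overlap {a b : Type*} [Fintype a] [Fintype b] (U : Matrix (a × b) (a × b) ℂ)
    (y : Matrix b a ℂ) : Matrix b a ℂ :=
  Matrix.of fun k c => (Fintype.card a : ℂ)⁻¹ * ∑ p, ∑ m, y m p * U (c, m) (p, k)

/-- The overlap is an average over `p` of products `F p * Uᵀ * G p` of a coisometry, a unitary and
an isometry; `G p` is isometric because column `p` of `y` is a unit vector. -/
theorem overlap_mul_conjTranspose_le_one {a b : Type*} [Fintype a] [DecidableEq a] [Fintype b]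
    [DecidableEq b] {U : Matrix (a × b) (a × b) ℂ} (hU : U ∈ Matrix.unitaryGroup (a × b) ℂ)
    {y : Matrix b a ℂ} (hy : yᴴ * y = 1) : overlap U y * (overlap U y)ᴴ ≤ 1 := by
  refine self_mul_conjTranspose_le_one ?_
  let F : a → Matrix b (a × b) ℂ := fun p => Matrix.of fun k q => if q = (p, k) then 1 else 0
  let G : a → Matrix (a × b) a ℂ := fun p => Matrix.of fun q c => if q.1 = c then y q.2 p else 0
  have hF : ∀ p, ‖F p‖ ≤ 1 := fun p => by
    refine norm_le_one_of_self_mul_conjTranspose ?_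
    ext k l
    simp [F, Matrix.mul_apply, Matrix.one_apply, apply_ite, eq_comm]
  have hG : ∀ p, ‖G p‖ ≤ 1 := fun p => by
    refine norm_le_one_of_conjTranspose_mul_self ?_
    ext c c'
    have h := congrFun (congrFun hy p) p
    simp only [Matrix.mul_apply, Matrix.conjTranspose_apply, Matrix.one_apply_eq] at h
    by_cases hcc : c = c'
    · subst hcc
      simpa [G, Matrix.mul_apply, Fintype.sum_prod_type, apply_ite, Finset.sum_ite_irrel] using h
    · simp [G, Matrix.mul_apply, Fintype.sum_prod_type, apply_ite, Finset.sum_ite_irrel, hcc,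
        Ne.symm hcc]
  have hUT : ‖Uᵀ‖ ≤ 1 := by
    refine norm_le_one_of_self_mul_conjTranspose ?_
    have h := congrArg Matrix.transpose (Matrix.mem_unitaryGroup_iff'.mp hU)
    rw [Matrix.transpose_mul, Matrix.transpose_one] at h
    exact h
  have hterm : ∀ p, ‖F p * Uᵀ * G p‖ ≤ 1 := fun p => by
    refine (Matrix.l2_opNorm_mul _ _).trans ?_
    refine mul_le_one₀ ((Matrix.l2_opNorm_mul _ _).trans ?_) (norm_nonneg _) (hG p)
    exact mul_le_one₀ (hF p) (norm_nonneg _) hUT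
  have hsum : overlap U y = (Fintype.card a : ℂ)⁻¹ • ∑ p, F p * Uᵀ * G p := by
    ext k c
    simp only [overlap, Matrix.of_apply, Matrix.smul_apply, smul_eq_mul, Matrix.sum_apply]
    congr 1
    refine Finset.sum_congr rfl fun p _ => ?_
    simp [F, G, Matrix.mul_apply, Fintype.sum_prod_type, Finset.sum_ite_irrel, mul_comm]
  rw [hsum, norm_smul, norm_inv, Complex.norm_natCast]
  have h1 : ‖∑ p, F p * Uᵀ * G p‖ ≤ Fintype.card a :=
    (norm_sum_le _ _).trans ((Finset.sum_le_sum fun p _ => hterm p).trans (by simp))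
  exact inv_mul_le_one_of_le₀ h1 (Nat.cast_nonneg _)

theorem le_one_of_mul_self_le_one {n : Type*} [Fintype n] [DecidableEq n] {A : Matrix n n ℂ}
    (hA : A.PosSemidef) (h : A * A ≤ 1) : A ≤ 1 := by
  have hps := Matrix.posSemidef_conjTranspose_mul_self A
  rw [hA.isHermitian.eq] at hps
  have h1 := (CStarAlgebra.norm_le_one_iff_of_nonneg _
    (Matrix.nonneg_iff_posSemidef.mpr hps)).mpr h
  have h2 := Matrix.l2_opNorm_conjTranspose_mul_self A
  rw [hA.isHermitian.eq] at h2
  refine (CStarAlgebra.norm_le_one_iff_of_nonneg _ (Matrix.nonneg_iff_posSemidef.mpr hA)).mp ?_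
  nlinarith [norm_nonneg A]

end Contraction

theorem trace_mul_re_nonneg {n : Type*} [Fintype n] [DecidableEq n] {A B : Matrix n n ℂ}
    (hA : A.PosSemidef) (hB : B.PosSemidef) : 0 ≤ (A * B).trace.re := by
  have h := (hA.mul_mul_conjTranspose_same (CFC.sqrt B)).trace_nonneg
  rw [Matrix.trace_mul_comm, ← Matrix.mul_assoc, sqrt_isHermitian, sqrt_mul_sqrt hB,
    Matrix.trace_mul_comm] at h
  exact (Complex.le_def.mp h).1

/-- With `s = √P ≤ 1`, one has `P = √s s √s ≤ √s √s = s`. -/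
theorem le_sqrt_of_le_one {n : Type*} [Fintype n] [DecidableEq n] {P : Matrix n n ℂ}
    (hP : P.PosSemidef) (hP1 : P ≤ 1) : P ≤ CFC.sqrt P := by
  have hs : (CFC.sqrt P).PosSemidef := Matrix.nonneg_iff_posSemidef.mp (CFC.sqrt_nonneg _)
  have hs1 : CFC.sqrt P ≤ 1 := le_one_of_mul_self_le_one hs (by rwa [sqrt_mul_sqrt hP])
  have h := mul_mul_conjTranspose_mono hs1 (CFC.sqrt (CFC.sqrt P))
  have hss := sqrt_mul_sqrt hs
  have hH := sqrt_isHermitian (CFC.sqrt P)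
  have hPP := sqrt_mul_sqrt hP
  set s := CFC.sqrt P
  set t := CFC.sqrt s
  rw [hH, Matrix.mul_one, hss] at h
  calc P = t * s * t := by rw [← hPP, ← hss]; simp only [Matrix.mul_assoc]
    _ ≤ s := h

/-! ### Factorizations of Choi matrices of reduced maps -/

/-- `|X|^{-1/2}` -/
noncomputable def invSqrtCard (x : Type*) [Fintype x] : ℂ := (((√(Fintype.card x : ℝ))⁻¹ : ℝ) : ℂ)

theorem invSqrtCard_mul_self (x : Type*) [Fintype x] :
    invSqrtCard x * invSqrtCard x = (Fintype.card x : ℂ)⁻¹ := by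
  rw [invSqrtCard, ← Complex.ofReal_mul, ← mul_inv, Real.mul_self_sqrt (Nat.cast_nonneg _)]
  simp

theorem star_invSqrtCard (x : Type*) [Fintype x] : star (invSqrtCard x) = invSqrtCard x := by
  simp [invSqrtCard]

/-- A factor of the Choi matrix of `ρ ↦ Tr_A[U (ρ ⊗ G G†) U†]`. -/
noncomputable def choiFactor {a b c : Type*} [Fintype a] [Fintype b] (U : Matrix (a × b) (a × b) ℂ)
    (G : Matrix b c ℂ) : Matrix (b × a) (c × a) ℂ :=
  Matrix.of fun u v => invSqrtCard a * ∑ q, U (v.2, u.1) (u.2, q) * G q v.1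

/-- The purifying system consists of the column index of `G` and the traced-out `A`. -/
theorem choi_reducedMap_Ad {a b c : Type*} [Fintype a] [DecidableEq a] [Fintype b]
    [DecidableEq b] [Fintype c] (U : Matrix (a × b) (a × b) ℂ) (G : Matrix b c ℂ) :
    choi (reducedMap (Ad U) (G * Gᴴ)) = choiFactor U G * (choiFactor U G)ᴴ := by
  have h : ∀ (p q i : a) (j l : b),
      (U * (Matrix.single p q (1 : ℂ) ⊗ₖ (G * Gᴴ)) * Uᴴ) (i, j) (i, l)
        = ∑ k, (∑ s, U (i, j) (p, s) * G s k) * star (∑ s, U (i, l) (q, s) * G s k) := by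
    intro p q i j l
    have h1 : (Matrix.single p q (1 : ℂ) ⊗ₖ (G * Gᴴ) : Matrix (a × b) (a × b) ℂ)
        = (Matrix.of fun (u : a × b) k => if p = u.1 then G u.2 k else 0)
          * (Matrix.of fun (u : a × b) k => if q = u.1 then G u.2 k else 0)ᴴ := by
      ext ⟨u, s⟩ ⟨v, t⟩
      by_cases hu : p = u <;> by_cases hv : q = v <;>
        simp [Matrix.mul_apply, hu, hv]
    rw [h1, ← Matrix.mul_assoc, Matrix.mul_assoc, ← Matrix.conjTranspose_mul, Matrix.mul_apply]
    refine Finset.sum_congr rfl fun k _ => ?_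
    simp [Matrix.mul_apply, Fintype.sum_prod_type, Finset.sum_ite_irrel]
  ext ⟨j, p⟩ ⟨l, q⟩
  simp only [choi, reducedMap, traceFst, opBlock, Ad, LinearMap.coe_mk, AddHom.coe_mk,
    Matrix.of_apply, Matrix.sum_apply, h]
  rw [Matrix.mul_apply]
  simp only [Matrix.conjTranspose_apply, choiFactor,
    Matrix.of_apply, Fintype.sum_prod_type, star_mul', star_invSqrtCard]
  conv_lhs => rw [Finset.sum_comm, Finset.mul_sum]
  refine Finset.sum_congr rfl fun k _ => ?_
  rw [Finset.mul_sum]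
  refine Finset.sum_congr rfl fun i _ => ?_
  rw [← invSqrtCard_mul_self]
  ring

theorem choi_reducedMap_add {a b : Type*} [Fintype a] [DecidableEq a] [Fintype b]
    (N : OpMap (a × b) (a × b)) (σ τ : Matrix b b ℂ) :
    choi (reducedMap N (σ + τ)) = choi (reducedMap N σ) + choi (reducedMap N τ) := by
  ext p q
  simp [choi, reducedMap, traceFst, opBlock, Matrix.kronecker_add, Finset.sum_add_distrib, mul_add,
    Matrix.sum_apply]

theorem choi_reducedMap_Ad_posSemidef {a b : Type*} [Fintype a] [DecidableEq a] [Fintype b]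
    [DecidableEq b] (U : Matrix (a × b) (a × b) ℂ) {σ : Matrix b b ℂ} (hσ : σ.PosSemidef) :
    (choi (reducedMap (Ad U) σ)).PosSemidef := by
  have h := choi_reducedMap_Ad U (CFC.sqrt σ)
  rw [sqrt_isHermitian, sqrt_mul_sqrt hσ] at h
  rw [h]
  exact Matrix.posSemidef_self_mul_conjTranspose _

/-- The Choi matrix of the reduced map is additive in the state and positive on the remainder `σ - G
G†`. -/
theorem choiFactor_mul_conjTranspose_le {a b c : Type*} [Fintype a] [DecidableEq a] [Fintype b]
    [DecidableEq b] [Fintype c] (U : Matrix (a × b) (a × b) ℂ) {σ : Matrix b b ℂ}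
    (G : Matrix b c ℂ) (hG : G * Gᴴ ≤ σ) :
    choiFactor U G * (choiFactor U G)ᴴ ≤ choi (reducedMap (Ad U) σ) := by
  have h := choi_reducedMap_Ad_posSemidef U (Matrix.le_iff.mp hG)
  rw [← choi_reducedMap_Ad, Matrix.le_iff]
  rwa [show choi (reducedMap (Ad U) σ) - choi (reducedMap (Ad U) (G * Gᴴ))
      = choi (reducedMap (Ad U) (σ - G * Gᴴ)) by
    rw [sub_eq_iff_eq_add, ← choi_reducedMap_add, sub_add_cancel]]

/-- The fidelity with the Choi matrix of a unitary operation. -/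
theorem fidelity_choi_Ad {a b : Type*} [Fintype a] [DecidableEq a] [Nonempty a] [Fintype b]
    [DecidableEq b] (U : Matrix (a × b) (a × b) ℂ) {σ : Matrix b b ℂ} (hσ : σ.PosSemidef)
    {Y : Matrix b a ℂ} (hY : Yᴴ * Y = 1) :
    fidelity (choi (reducedMap (Ad U) σ)) (choi (Ad Y))
      = (overlap U (Y.map star) * (overlap U (Y.map star))ᴴ * σᵀ).trace.re := by
  have hd : (Fintype.card a : ℂ) ≠ 0 := by simp
  have hη : choi (Ad Y) = Matrix.vecMulVec (invSqrtCard a • vec Y) (star (invSqrtCard a • vec Y)) := by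
    rw [choi_Ad, star_smul, star_invSqrtCard, Matrix.smul_vecMulVec, Matrix.vecMulVec_smul,
      smul_smul, invSqrtCard_mul_self]
  have hnorm : star (invSqrtCard a • vec Y) ⬝ᵥ (invSqrtCard a • vec Y) = 1 := by
    have h1 : star (vec Y) ⬝ᵥ vec Y = (Yᴴ * Y).trace := by
      simp only [dotProduct, vec, Fintype.sum_prod_type, Matrix.trace, Matrix.diag,
        Matrix.mul_apply, Matrix.conjTranspose_apply, Pi.star_apply]
      exact Finset.sum_comm
    rw [star_smul, star_invSqrtCard, smul_dotProduct, dotProduct_smul, smul_smul,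
      invSqrtCard_mul_self, h1, hY, Matrix.trace_one, smul_eq_mul, inv_mul_cancel₀ hd]
  rw [hη, fidelity_vecMulVec (choi_reducedMap_Ad_posSemidef U hσ) _ hnorm]
  congr 1
  have hG := choi_reducedMap_Ad U (CFC.sqrt σ)
  rw [sqrt_isHermitian, sqrt_mul_sqrt hσ] at hG
  have hSS : CFC.sqrt σ * (CFC.sqrt σ)ᴴ = σ := by rw [sqrt_isHermitian, sqrt_mul_sqrt hσ]
  rw [hG]
  set G := CFC.sqrt σ
  set η := invSqrtCard a • vec Y
  set K := (overlap U (Y.map star))ᵀ with hK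
  -- Contracting the factor with the vectorized `Y` leaves `Lᵀ √σ`. Transposing the resulting trace
  -- produces `σᵀ`, the matrix that also enters the non-catalyticity.
  have hv : ∀ (k : b) (i : a), (star η ᵥ* choiFactor U G) (k, i) = (K * G) i k := by
    intro k i
    simp only [η, hK, Matrix.vecMul, dotProduct, choiFactor, Matrix.of_apply, vec, Pi.star_apply,
      Pi.smul_apply, smul_eq_mul, star_mul', star_invSqrtCard, Fintype.sum_prod_type,
      Matrix.mul_apply, Matrix.transpose_apply, overlap, Matrix.map_apply, Finset.mul_sum,
      Finset.sum_mul]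
    rw [Finset.sum_comm]
    conv_rhs => rw [Finset.sum_comm]
    refine Finset.sum_congr rfl fun p _ => ?_
    conv_rhs => rw [Finset.sum_comm]
    refine Finset.sum_congr rfl fun m _ => Finset.sum_congr rfl fun q _ => ?_
    rw [← invSqrtCard_mul_self]
    ring
  have h1 : star η ⬝ᵥ (choiFactor U G * (choiFactor U G)ᴴ) *ᵥ η = (K * G * (K * G)ᴴ).trace := by
    have h2 : (choiFactor U G)ᴴ *ᵥ η = star (star η ᵥ* choiFactor U G) := by
      rw [Matrix.star_vecMul, star_star]
    rw [← Matrix.mulVec_mulVec, h2, Matrix.dotProduct_mulVec]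
    simp only [dotProduct, Fintype.sum_prod_type, hv, Pi.star_apply, Matrix.trace, Matrix.diag,
      Matrix.mul_apply (M := K * G), Matrix.conjTranspose_apply]
    exact Finset.sum_comm
  rw [h1, Matrix.conjTranspose_mul, Matrix.mul_assoc, ← Matrix.mul_assoc G, hSS,
    ← Matrix.trace_transpose, Matrix.transpose_mul, Matrix.transpose_mul, hK,
    Matrix.transpose_transpose, Matrix.trace_mul_comm, ← Matrix.mul_assoc]
  rfl

/-! ### Comparison of the two fidelities -/

/-- Uniqueness of the positive square root: `1 ⊗ √τ` and `W (1 ⊗ √σ) W†` both square to `1 ⊗ τ`. -/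
theorem one_kronecker_sqrt_mul {b : Type*} [Fintype b] [DecidableEq b]
    {W : Matrix (b × b) (b × b) ℂ} (hW : W ∈ Matrix.unitaryGroup (b × b) ℂ) {σ τ : Matrix b b ℂ}
    (hσ : σ.PosSemidef) (hτ : τ.PosSemidef)
    (h : W * ((1 : Matrix b b ℂ) ⊗ₖ σ) * Wᴴ = (1 : Matrix b b ℂ) ⊗ₖ τ) :
    W * ((1 : Matrix b b ℂ) ⊗ₖ CFC.sqrt σ) = ((1 : Matrix b b ℂ) ⊗ₖ CFC.sqrt τ) * W := by
  have hWW : Wᴴ * W = 1 := Matrix.mem_unitaryGroup_iff'.mp hW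
  have hps : ∀ ρ : Matrix b b ℂ, ((1 : Matrix b b ℂ) ⊗ₖ CFC.sqrt ρ).PosSemidef := fun ρ =>
    Matrix.PosSemidef.one.kronecker (Matrix.nonneg_iff_posSemidef.mp (CFC.sqrt_nonneg ρ))
  have hsq : ∀ {ρ : Matrix b b ℂ}, ρ.PosSemidef → ((1 : Matrix b b ℂ) ⊗ₖ CFC.sqrt ρ)
      * ((1 : Matrix b b ℂ) ⊗ₖ CFC.sqrt ρ) = (1 : Matrix b b ℂ) ⊗ₖ ρ := fun hρ => by
    rw [← Matrix.mul_kronecker_mul, sqrt_mul_sqrt hρ, Matrix.one_mul]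
  have h1 : CFC.sqrt ((1 : Matrix b b ℂ) ⊗ₖ τ) = (1 : Matrix b b ℂ) ⊗ₖ CFC.sqrt τ :=
    CFC.sqrt_unique (hsq hτ) (Matrix.nonneg_iff_posSemidef.mpr (hps τ))
  have h2 : CFC.sqrt ((1 : Matrix b b ℂ) ⊗ₖ τ) = W * ((1 : Matrix b b ℂ) ⊗ₖ CFC.sqrt σ) * Wᴴ := by
    refine CFC.sqrt_unique ?_ (Matrix.nonneg_iff_posSemidef.mpr
      ((hps σ).mul_mul_conjTranspose_same W))
    calc _ = W * (((1 : Matrix b b ℂ) ⊗ₖ CFC.sqrt σ) * (Wᴴ * W)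
          * ((1 : Matrix b b ℂ) ⊗ₖ CFC.sqrt σ)) * Wᴴ := by simp only [Matrix.mul_assoc]
      _ = _ := by rw [hWW, Matrix.mul_one, hsq hσ, h]
  rw [← h1, h2, Matrix.mul_assoc, hWW, Matrix.mul_one]

/-- The fidelity that bounds the non-catalyticity of `W` is at least the square of the fidelity that
enters the non-leakage of `U`. -/
theorem sq_le_fidelity_choi_reducedMap {a b : Type*} [Fintype a] [DecidableEq a] [Nonempty a]
    [Fintype b] [DecidableEq b] [Nonempty b] (hcard : Fintype.card a = Fintype.card b)
    {U : Matrix (a × b) (a × b) ℂ} (hU : U ∈ Matrix.unitaryGroup (a × b) ℂ)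
    {W : Matrix (b × b) (b × b) ℂ} (hW : W ∈ Matrix.unitaryGroup (b × b) ℂ)
    (hUW : IsCompatibleMap W (Ad U)) {σ τ : Matrix b b ℂ} (hσ : σ.PosSemidef) (hτ : τ.PosSemidef)
    (h : W * ((1 : Matrix b b ℂ) ⊗ₖ σ) * Wᴴ = (1 : Matrix b b ℂ) ⊗ₖ τ)
    {y : Matrix b a ℂ} (hy : yᴴ * y = 1) (hy' : y * yᴴ = 1) :
    (overlap U y * (overlap U y)ᴴ * σ).trace.re ^ 2
      ≤ fidelity (choi (reducedMap (Ad W) σ))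
          (τ ⊗ₖ ((Fintype.card b : ℂ)⁻¹ • (1 : Matrix b b ℂ))) := by
  have hd : (Fintype.card b : ℂ) ≠ 0 := by simp
  have hSW := one_kronecker_sqrt_mul hW hσ hτ h
  have hWW : Wᴴ * W = 1 := Matrix.mem_unitaryGroup_iff'.mp hW
  have hLP : (overlap U y * (overlap U y)ᴴ).PosSemidef :=
    Matrix.posSemidef_self_mul_conjTranspose _
  have hL1 := overlap_mul_conjTranspose_le_one hU hy
  -- `Q` is the polar part of `L = overlap U y`, chosen so that `L Q† = √(L L†)`. It is only a
  -- contraction, hence the use of sub-purifications.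
  obtain ⟨Q, -, hQ, hQ'⟩ := exists_eq_sqrt_mul hLP (overlap U y) le_rfl
  have hLQ := hQ' rfl
  set S := CFC.sqrt σ
  have hSH : Sᴴ = S := sqrt_isHermitian σ
  have hSS : S * S = σ := sqrt_mul_sqrt hσ
  set T := CFC.sqrt τ
  have hTH : Tᴴ = T := sqrt_isHermitian τ
  have hTT : T * T = τ := sqrt_mul_sqrt hτ
  set r := invSqrtCard b with hr
  have hrr : r * r = (Fintype.card b : ℂ)⁻¹ := invSqrtCard_mul_self b
  have hrs : star r = r := star_invSqrtCard b
  have hSQ : S * Q * (S * Q)ᴴ ≤ σ := by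
    have := mul_mul_conjTranspose_mono hQ S
    rw [Matrix.mul_one, hSH, hSS] at this
    rw [Matrix.conjTranspose_mul, hSH]
    simpa only [Matrix.mul_assoc] using this
  -- the factor of `τ ⊗ π`
  let V : Matrix (b × a) (a × b) ℂ := Matrix.of fun u v => (W * realign U) (v.2, u.1) (v.1, u.2)
  have hV : V * Vᴴ = 1 := by
    ext ⟨k, p⟩ ⟨l, q⟩
    have := hUW.sum_realign p q k l
    rw [Matrix.mul_apply, Fintype.sum_prod_type]
    simpa [V, Matrix.one_apply] using this
  let Z : Matrix (b × b) (a × b) ℂ := r • ((T ⊗ₖ y) * V)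
  have hZ : Z * Zᴴ = τ ⊗ₖ ((Fintype.card b : ℂ)⁻¹ • (1 : Matrix b b ℂ)) := by
    simp only [Z]
    rw [Matrix.conjTranspose_smul, hrs, Matrix.smul_mul, Matrix.mul_smul, smul_smul, hrr,
      Matrix.conjTranspose_mul, Matrix.mul_assoc, ← Matrix.mul_assoc V, hV, Matrix.one_mul,
      Matrix.conjTranspose_kronecker, ← Matrix.mul_kronecker_mul, hTH, hTT, hy',
      Matrix.kronecker_smul]
  have hτπ : (τ ⊗ₖ ((Fintype.card b : ℂ)⁻¹ • (1 : Matrix b b ℂ))).PosSemidef :=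
    hZ ▸ Matrix.posSemidef_self_mul_conjTranspose Z
  have hfid := norm_trace_sq_le_fidelity (choi_reducedMap_Ad_posSemidef W hσ) hτπ
    (choiFactor W (S * Q)) Z (choiFactor_mul_conjTranspose_le W (S * Q) hSQ) hZ.le
  refine le_trans ?_ hfid
  -- the two factors, regrouped as operators from `B ⊗ A` to `B ⊗ B'`
  let R : Matrix (a × a) (b × a) ℂ := Matrix.of fun u v => if u.1 = v.2 then y v.1 u.2 else 0
  let X₁ : Matrix (b × b) (b × a) ℂ := W * ((1 : Matrix b b ℂ) ⊗ₖ (S * Q))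
  let Z₁ : Matrix (b × b) (b × a) ℂ := W * ((1 : Matrix b b ℂ) ⊗ₖ S) * realign U * R
  have hX₁ : ∀ i k m c, choiFactor W (S * Q) (k, m) (c, i) = r * X₁ (i, k) (m, c) := by
    intro i k m c
    simp [choiFactor, X₁, Matrix.mul_apply (M := W), Fintype.sum_prod_type, Matrix.one_apply,
      Finset.sum_ite_irrel, hr]
  -- The intertwining relation trades `√τ` after `W` for `√σ` before it, putting `W` leftmost as in
  -- `X₁`.
  have hZ₁ : ∀ i k m c, Z (k, m) (c, i) = r * Z₁ (i, k) (m, c) := by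
    intro i k m c
    simp only [Z, Z₁, hSW, Matrix.smul_apply, smul_eq_mul]
    congr 1
    rw [Matrix.mul_assoc _ W]
    simp only [V]
    generalize W * realign U = N
    simp only [Matrix.mul_apply, Fintype.sum_prod_type, R, Matrix.of_apply,
      Matrix.kroneckerMap_apply, Matrix.one_apply, ite_mul, one_mul, zero_mul, mul_ite, mul_zero,
      Finset.sum_ite_irrel, Finset.sum_const_zero, Finset.sum_ite_eq, Finset.sum_ite_eq',
      Finset.mem_univ, if_true, Finset.sum_mul]
    rw [Finset.sum_comm]
    refine Finset.sum_congr rfl fun p _ => Finset.sum_congr rfl fun k' _ => ?_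
    ring
  have htr : ((choiFactor W (S * Q))ᴴ * Z).trace
      = (CFC.sqrt (overlap U y * (overlap U y)ᴴ) * σ).trace := by
    have e1 : ((choiFactor W (S * Q))ᴴ * Z).trace = r * r * (X₁ᴴ * Z₁).trace := by
      simp only [Matrix.trace, Matrix.diag, Matrix.mul_apply (M := (choiFactor W (S * Q))ᴴ),
        Matrix.mul_apply (M := X₁ᴴ), Matrix.conjTranspose_apply, Fintype.sum_prod_type, hX₁, hZ₁,
        star_mul', hrs, Finset.mul_sum]
      conv_rhs => rw [Finset.sum_comm]
      refine Finset.sum_congr rfl fun c _ => ?_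
      conv_rhs => rw [Finset.sum_comm]
      refine Finset.sum_congr rfl fun i _ => ?_
      conv_rhs => rw [Finset.sum_comm]
      refine Finset.sum_congr rfl fun k _ => Finset.sum_congr rfl fun m _ => ?_
      ring
    have e2 : X₁ᴴ * Z₁ = ((1 : Matrix b b ℂ) ⊗ₖ (Qᴴ * σ)) * (realign U * R) := by
      simp only [X₁, Z₁]
      rw [Matrix.conjTranspose_mul, Matrix.conjTranspose_kronecker, Matrix.conjTranspose_one,
        Matrix.conjTranspose_mul, hSH]
      calc _ = ((1 : Matrix b b ℂ) ⊗ₖ (Qᴴ * S)) * (Wᴴ * W) * ((1 : Matrix b b ℂ) ⊗ₖ S)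
            * (realign U * R) := by simp only [Matrix.mul_assoc]
        _ = _ := by
          rw [hWW, Matrix.mul_one, ← Matrix.mul_kronecker_mul, Matrix.one_mul, Matrix.mul_assoc,
            hSS]
    -- Tracing out the first factor of `realign U * R` pairs `U` with `y`, giving `|A|` times the
    -- overlap; `|A| = |B|` lets this cancel the normalization `r * r`.
    have e3 : (((1 : Matrix b b ℂ) ⊗ₖ (Qᴴ * σ)) * (realign U * R)).trace
        = (Fintype.card b : ℂ) * (Qᴴ * σ * overlap U y).trace := by
      generalize Qᴴ * σ = M
      have h4 : ∀ q c, ∑ m, (realign U * R) (m, q) (m, c) = (Fintype.card b : ℂ) * overlap U y q c := by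
        intro q c
        simp only [overlap, Matrix.of_apply, hcard]
        rw [← mul_assoc, mul_inv_cancel₀ hd, one_mul, Finset.sum_comm]
        refine Finset.sum_congr rfl fun m _ => ?_
        simp [Matrix.mul_apply, R, realign, Fintype.sum_prod_type, Finset.sum_ite_irrel, mul_comm]
      simp only [Matrix.trace, Matrix.diag, Matrix.mul_apply (M := M),
        Matrix.mul_apply (M := (1 : Matrix b b ℂ) ⊗ₖ M), Fintype.sum_prod_type,
        Matrix.kroneckerMap_apply, Matrix.one_apply, ite_mul, one_mul, zero_mul,
        Finset.sum_ite_irrel, Finset.sum_const_zero, Finset.sum_ite_eq, Finset.mem_univ, if_true,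
        Finset.mul_sum]
      rw [Finset.sum_comm]
      refine Finset.sum_congr rfl fun c _ => ?_
      rw [Finset.sum_comm]
      refine Finset.sum_congr rfl fun q _ => ?_
      rw [← Finset.mul_sum, h4]
      ring
    rw [e1, e2, e3, hrr, ← mul_assoc, inv_mul_cancel₀ hd, one_mul, Matrix.trace_mul_comm,
      ← Matrix.mul_assoc, hLQ]
  rw [htr]
  have h5 : (overlap U y * (overlap U y)ᴴ * σ).trace.re
      ≤ (CFC.sqrt (overlap U y * (overlap U y)ᴴ) * σ).trace.re := by
    have := trace_mul_re_nonneg (Matrix.le_iff.mp (le_sqrt_of_le_one hLP hL1)) hσ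
    rw [Matrix.sub_mul, Matrix.trace_sub, Complex.sub_re] at this
    linarith
  exact pow_le_pow_left₀ (trace_mul_re_nonneg hLP hσ) (h5.trans (Complex.re_le_norm _)) 2

/-- For `c ≤ 1`, `1 - f ≤ (1 - c)(1 + c) ≤ 2(1 - c)`, so `√2` would already do. The case `c ≥ 1`,
where the left side is zero, avoids having to prove that the fidelity is at most one. -/
theorem sqrt_one_sub_le_two_mul_sqrt_one_sub {c f : ℝ} (hc : 0 ≤ c) (h : c ^ 2 ≤ f) :
    √(1 - f) ≤ 2 * √(1 - c) := by
  rcases le_total c 1 with h1 | h1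
  · rw [Real.sqrt_le_left (by positivity), mul_pow, Real.sq_sqrt (by linarith)]
    nlinarith
  · rw [Real.sqrt_eq_zero_of_nonpos (by nlinarith)]
    positivity

end QTime

theorem mainTheorem8 {a b : Type*} [Fintype a] [DecidableEq a] [Fintype b] [DecidableEq b]
    (hcard : Fintype.card a = Fintype.card b)
    (U : Matrix (a × b) (a × b) ℂ) (hU : U ∈ Matrix.unitaryGroup (a × b) ℂ)
    (W : Matrix (b × b) (b × b) ℂ) (hW : W ∈ Matrix.unitaryGroup (b × b) ℂ)
    (hUW : QTime.IsCompatibleMap W (QTime.Ad U))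
    (σ : Matrix b b ℂ) (hσ : QTime.IsState σ) (hσW : QTime.IsCompatibleState W σ) :
    QTime.nonCatalyticity (QTime.Ad W) σ ≤ 2 * QTime.nonLeakage (QTime.Ad U) σ := by
  have hb : Nonempty b := by
    by_contra hb
    have := not_nonempty_iff.mp hb
    simpa using hσ.2
  have ha : Nonempty a := Fintype.card_pos_iff.mp (hcard ▸ Fintype.card_pos)
  obtain ⟨τ, hτ, hWτ⟩ := hσW.exists_state hW hσ
  obtain ⟨e⟩ := Fintype.card_eq.mp hcard
  -- A permutation matrix shows that the infimum over unitaries is not over an empty set.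
  have hY : Nonempty {Y : Matrix b a ℂ // Yᴴ * Y = 1 ∧ Y * Yᴴ = 1} :=
    ⟨⟨(1 : Matrix a a ℂ).submatrix e.symm id, by
      rw [Matrix.conjTranspose_submatrix, Matrix.conjTranspose_one]
      constructor
      · rw [Matrix.submatrix_mul_equiv _ _ id e.symm id]; simp
      · rw [Matrix.submatrix_mul _ _ _ id _ Function.bijective_id |>.symm]; simp⟩⟩
  rw [QTime.nonLeakage, QTime.infoDestruction, Real.mul_iInf_of_nonneg zero_le_two]
  refine le_ciInf fun Y => ?_
  obtain ⟨Y, hY1, hY2⟩ := Y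
  -- The same `τ` works for every `Y`.
  refine (ciInf_le ⟨0, ?_⟩ ⟨τ, hτ⟩).trans ?_
  · rintro _ ⟨ξ, rfl⟩
    exact Real.sqrt_nonneg _
  unfold QTime.sineDist
  rw [QTime.fidelity_choi_Ad U hσ.1 hY1]
  have hm : (Y.map star)ᴴ = Yᵀ := by
    ext i j
    simp
  have hm1 : (Y.map star)ᴴ * Y.map star = 1 := by
    rw [hm, ← Matrix.transpose_one, ← hY1, Matrix.transpose_mul]
    rfl
  have hm2 : Y.map star * (Y.map star)ᴴ = 1 := by
    rw [hm, ← Matrix.transpose_one, ← hY2, Matrix.transpose_mul]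
    rfl
  exact QTime.sqrt_one_sub_le_two_mul_sqrt_one_sub
    (QTime.trace_mul_re_nonneg (Matrix.posSemidef_self_mul_conjTranspose _) hσ.1.transpose)
    (QTime.sq_le_fidelity_choi_reducedMap hcard hU hW hUW hσ.1.transpose hτ.1 hWτ hm1 hm2)
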